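/- Let $I=[-1,1]$ and let $r\ge 1$ be an integer. Let $\mathcal X^{\mathrm{eq}}=\{\xi_0,\dots,\xi_r\}$ with $\xi_i=-1+\frac{2i}{r}$ be the equidistant nodes of $I$, and let $\mathcal S^{\mathrm{eq}}=\{s_1,\dots,s_r\}$ with $s_i=[\xi_{i-1},\xi_i]$ be the equidistant segments, of length $|s_i|=\frac2r$. Let $\ell_{\xi_0},\dots,\ell_{\xi_r}$ be the Lagrange polynomials of degree $r$ of the nodes, and put $$\Lambda_{r+1}(\mathcal X^{\mathrm{eq}})=\sup_{x\in I}\sum_{i=0}^{r}|\ell_{\xi_i}(x)|,\qquad (\Pi_{r+1}(\mathcal X^{\mathrm{eq}})f)(x)=\sum_{i=0}^{r} f(\xi_i)\,\ell_{\xi_i}(x).$$ There is exactly one system $\ell_{s_1},\dots,\ell_{s_r}$ of real polynomials of degree at most $r-1$ with $\int_{s_i}\ell_{s_j}(x)\,dx=\delta_{ij}$ for all $i,j\in\{1,\dots,r\}$. With this system put $$\Lambda_r(\mathcal S^{\mathrm{eq}})=\sup_{-1\le a<b\le 1}\frac1{b-a}\sum_{i=1}^r|s_i|\left|\int_a^b\ell_{s_i}(x)\,dx\right|,\qquad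 (\Pi_r(\mathcal S^{\mathrm{eq}})g)(x)=\sum_{i=1}^r\left(\int_{s_i}g(t)\,dt\right)\ell_{s_i}(x).$$ (The first supremum equals $\sup_{x\in I}\sum_{i=1}^r|s_i||\ell_{s_i}(x)|$.) Then the following hold. 1. For every differentiable $f:I\to\mathbb C$ whose derivative is integrable on $I$ one has $\Pi_r(\mathcal S^{\mathrm{eq}})f'=(\Pi_{r+1}(\mathcal X^{\mathrm{eq}})f)'$. 2. $\displaystyle \frac1\pi\,\frac{2^{r-1}}{r^2}<\Lambda_r(\mathcal S^{\mathrm{eq}})$. 3. $\displaystyle \Lambda_r(\mathcal S^{\mathrm{eq}})\le 2r^2\,\Lambda_{r+1}(\mathcal X^{\mathrm{eq}})$. 4. $\displaystyle \Lambda_r(\mathcal S^{\mathrm{eq}})\le r\,2^{r+4}$. In particular, $\Lambda_r(\mathcal S^{\mathrm{eq}})$ grows exponentially in $r$: $\lim_{r\to\infty}\Lambda_r(\mathcal S^{\mathrm{eq}})^{1/r}=2$. -/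

import Mathlib

open Set Filter Topology MeasureTheory

noncomputable section

namespace SegInterp

/-- A system `ℓ` of `r` real polynomials of degree at most `r - 1` that is dual to integration over
the segments `[α i, β i]`: the integral of `ℓ j` over the segment `i` is `1` if `i = j`, else `0`. -/
def IsSegmentLagrangeBasis {r : ℕ} (α β : Fin r → ℝ) (ℓ : Fin r → Polynomial ℝ) : Prop :=
  (∀ j, ℓ j ∈ Polynomial.degreeLT ℝ r) ∧
    ∀ i j, ∫ x in (α i)..(β i), (ℓ j).eval x = if i = j then 1 else 0

open Classical in
/-- The Lagrange basis of a family of segments `[α i, β i]` (with the value `0` if there is none). -/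
def segmentLagrange {r : ℕ} (α β : Fin r → ℝ) : Fin r → Polynomial ℝ :=
  if h : ∃ ℓ, IsSegmentLagrangeBasis α β ℓ then h.choose else 0

/-- The segmental interpolation operator `f ↦ ∑ i, (∫_{s_i} f) ℓ_{s_i}`, as a function of `x`. -/
def segmentInterp {r : ℕ} (α β : Fin r → ℝ) (f : ℝ → ℂ) (x : ℝ) : ℂ :=
  ∑ i, (∫ t in (α i)..(β i), f t) * (((segmentLagrange α β i).eval x : ℝ) : ℂ)

/-- The segmental Lebesgue constant on `I = [-1, 1]`: the supremum over all intervals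
`[a, b] ⊆ I` with `a < b` of `(b - a)⁻¹ ∑ i, |s_i| |∫_a^b ℓ_{s_i}|`. -/
def segmentLebesgue {r : ℕ} (α β : Fin r → ℝ) : ℝ :=
  sSup {y : ℝ | ∃ a b : ℝ, -1 ≤ a ∧ a < b ∧ b ≤ 1 ∧
    y = 1 / (b - a) * ∑ i, (β i - α i) * |∫ x in a..b, (segmentLagrange α β i).eval x|}

/-- The nodal Lagrange polynomials of the nodes `ξ i`. -/
def nodalLagrange {n : ℕ} (ξ : Fin n → ℝ) (i : Fin n) : Polynomial ℝ :=
  Lagrange.basis Finset.univ ξ i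

/-- The nodal interpolation operator `f ↦ ∑ i, f(ξ_i) ℓ_{ξ_i}`, as a function of `x`. -/
def nodalInterp {n : ℕ} (ξ : Fin n → ℝ) (f : ℝ → ℂ) (x : ℝ) : ℂ :=
  ∑ i, f (ξ i) * (((nodalLagrange ξ i).eval x : ℝ) : ℂ)

/-- The nodal Lebesgue constant on `I = [-1, 1]`. -/
def nodalLebesgue {n : ℕ} (ξ : Fin n → ℝ) : ℝ :=
  sSup ((fun x : ℝ => ∑ i, |(nodalLagrange ξ i).eval x|) '' Icc (-1) 1)

/-- The `r + 1` equidistant nodes `-1 + 2 i / r`, `i = 0, …, r`, of `[-1, 1]`. -/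
def eqNodes (r : ℕ) (i : Fin (r + 1)) : ℝ := -1 + 2 * (i : ℝ) / (r : ℝ)

/-- The left endpoints of the `r` equidistant segments. -/
def eqLeft (r : ℕ) (i : Fin r) : ℝ := eqNodes r i.castSucc

/-- The right endpoints of the `r` equidistant segments. -/
def eqRight (r : ℕ) (i : Fin r) : ℝ := eqNodes r i.succ

/-- The segmental Lebesgue constant is also a supremum of pointwise values. -/
theorem segmentLebesgue_eq_pointwise {r : ℕ} (α β : Fin r → ℝ) (h : ∀ i, α i ≤ β i) :
    segmentLebesgue α β = sSup ((fun x : ℝ =>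
      ∑ i, (β i - α i) * |(segmentLagrange α β i).eval x|) '' Icc (-1) 1) := by
  set p := segmentLagrange α β
  set F : ℝ → ℝ := fun x => ∑ i, (β i - α i) * |(p i).eval x| with hF
  have hFc : Continuous F := by
    refine continuous_finsetSum _ fun i _ => ?_
    exact continuous_const.mul (p i).continuous.abs
  have hbdd : BddAbove (F '' Icc (-1) 1) :=
    (isCompact_Icc.image hFc).bddAbove
  have hne : (F '' Icc (-1 : ℝ) 1).Nonempty := ⟨F 0, 0, by constructor <;> norm_num, rfl⟩
  have hlub := isLUB_csSup hne hbdd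
  unfold segmentLebesgue
  refine IsLUB.csSup_eq ⟨?_, ?_⟩ ⟨_, -1, 1, le_rfl, by norm_num, le_rfl, rfl⟩
  · rintro y ⟨a, b, ha, hab, hb, rfl⟩
    set M := sSup (F '' Icc (-1 : ℝ) 1)
    have h1 : ∑ i, (β i - α i) * |∫ x in a..b, (p i).eval x| ≤ ∫ x in a..b, F x := by
      rw [hF, intervalIntegral.integral_finsetSum]
      · refine Finset.sum_le_sum fun i _ => ?_
        rw [intervalIntegral.integral_const_mul]
        exact mul_le_mul_of_nonneg_left (intervalIntegral.abs_integral_le_integral_abs hab.le)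
          (sub_nonneg.2 (h i))
      · intro i _
        exact (continuous_const.mul (p i).continuous.abs).intervalIntegrable _ _
    have h2 : ∫ x in a..b, F x ≤ ∫ _x in a..b, M := by
      refine intervalIntegral.integral_mono_on hab.le (hFc.intervalIntegrable _ _)
        (continuous_const.intervalIntegrable _ _) fun x hx => ?_
      exact hlub.1 ⟨x, ⟨ha.trans hx.1, hx.2.trans hb⟩, rfl⟩
    rw [intervalIntegral.integral_const, smul_eq_mul] at h2
    have h3 : 0 < b - a := sub_pos.2 hab
    rw [one_div, inv_mul_le_iff₀ h3]
    exact h1.trans h2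
  · intro c hc
    refine hlub.2 ?_
    have hcl : IsClosed {x | F x ≤ c} := isClosed_le hFc continuous_const
    have hsub : Ioo (-1 : ℝ) 1 ⊆ {x | F x ≤ c} := by
      intro x hx
      have hd : Tendsto (fun b => ∑ i, (β i - α i) * |(b - x)⁻¹ * ∫ t in x..b, (p i).eval t|)
          (𝓝[>] x) (𝓝 (F x)) := by
        refine tendsto_finsetSum _ fun i _ => Tendsto.const_mul _ (Tendsto.abs ?_)
        have := intervalIntegral.integral_hasDerivAt_right
          ((p i).continuous.intervalIntegrable (μ := volume) x x)
          ((p i).continuous.stronglyMeasurableAtFilter volume _) (p i).continuous.continuousAt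
        have h2 := (hasDerivAt_iff_tendsto_slope.1 this).mono_left
          (nhdsWithin_mono x (fun y (hy : x < y) => ne_of_gt hy))
        refine h2.congr fun b => ?_
        simp [slope_def_field, div_eq_inv_mul]
      refine le_of_tendsto hd ?_
      filter_upwards [Ioo_mem_nhdsGT hx.2] with b hb
      have := hc ⟨x, b, hx.1.le, hb.1, hb.2.le, rfl⟩
      refine le_trans (le_of_eq ?_) this
      have h3 : 0 < b - x := sub_pos.2 hb.1
      rw [Finset.mul_sum]
      refine Finset.sum_congr rfl fun i _ => ?_
      rw [abs_mul, abs_of_pos (inv_pos.2 h3), one_div]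
      ring
    have := hcl.closure_subset_iff.2 hsub
    rw [closure_Ioo (by norm_num)] at this
    rintro _ ⟨x, hx, rfl⟩
    exact this hx

end SegInterp

end

/-! The dual basis of the equidistant segments is explicit. Let `stepPoly r j` be the polynomial
of degree at most `r` with value `-1/2` at the nodes up to `ξ_j` and `1/2` at the later ones. By
the fundamental theorem of calculus the integral of its derivative over the segment `i` is the
jump of its node values there, namely `1` if `i = j` and `0` otherwise. So the derivatives of the
step polynomials form a dual system, and it is the only one because a primitive of a polynomial
with vanishing segment integrals is constant on the `r + 1` nodes. In the same way each derivative
of a nodal Lagrange polynomial is the difference of the segmental Lagrange polynomials of the two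
adjacent segments (only one of them exists at `±1`; see `derivative_nodalLagrange_eq`), and
summation by parts yields the commutation of interpolation with differentiation
(`hasDerivAt_nodalInterp`).

*Comparison with the nodal constant.* With suitable signs, `∑ |s_i| |ℓ_{s_i}(x)|` is `P'(x)` for a
combination `P` of step polynomials. All node values of `P` are at most `1` in absolute value, so
`|P|` is bounded on `[-1, 1]` by the nodal Lebesgue constant. Markov's inequality, with a loss of
a factor `2`, bounds `P'(x)` (`abs_derivative_eval_le`); it follows from the extremality of the
Chebyshev polynomials at the endpoint `1`, applied on the longer one of the intervals `[-1, x]`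
and `[x, 1]`.

*Upper bound.* If `x` lies in the grid cell number `m` (counted from `0`), comparing its distances
to the nodes with integers bounds the `k`-th Lagrange polynomial by `(m+1)! (r-m)! / r!` times
`r.choose k`, divided by the distance in grid steps from the node `k` to the farther endpoint of
the cell. In the interior cells the first factor is at most `2 / r`; in the first and the last
cell the divisor provides a factor `1 / r` instead. Hence `nodalLebesgue_eqNodes_le`.

*Lower bound.* At `x = -1`, the derivative of the nodal Lagrange polynomial `k ≥ 1` is
`r / (2 k) * r.choose k` in absolute value, and the sum of these numbers is at most twice the sum of the
absolute values of the segmental Lagrange polynomials.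

The exponential growth follows from the two bounds since `r ^ (1 / r)` tends to `1`. -/

namespace SegInterp

open Polynomial

/-! ### The Lagrange basis of the equidistant segments -/

theorem eqNodes_injective {r : ℕ} (hr : 1 ≤ r) : Function.Injective (eqNodes r) := by
  intro i j h
  have hr' : (r : ℝ) ≠ 0 := by positivity
  unfold eqNodes at h
  field_simp at h
  have : (i : ℝ) = j := by linarith
  exact Fin.ext (by exact_mod_cast this)

theorem eqNodes_mem_Icc {r : ℕ} (hr : 1 ≤ r) (i : Fin (r + 1)) : eqNodes r i ∈ Icc (-1 : ℝ) 1 := by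
  have hr' : (0 : ℝ) < r := by positivity
  have hi : (i : ℝ) ≤ r := by exact_mod_cast Nat.lt_succ_iff.1 i.2
  unfold eqNodes
  constructor
  · have : 0 ≤ 2 * (i : ℝ) / r := by positivity
    linarith
  · have : 2 * (i : ℝ) / r ≤ 2 := by rw [div_le_iff₀ hr']; linarith
    linarith

theorem eqRight_sub_eqLeft {r : ℕ} (i : Fin r) : eqRight r i - eqLeft r i = 2 / r := by
  simp only [eqRight, eqLeft, eqNodes, Fin.val_succ, Fin.val_castSucc, Nat.cast_add, Nat.cast_one]
  ring

theorem eqLeft_le_eqRight {r : ℕ} (i : Fin r) : eqLeft r i ≤ eqRight r i := by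
  have h := eqRight_sub_eqLeft i
  have : (0 : ℝ) ≤ 2 / r := by positivity
  linarith

theorem integral_derivative_eval (p : ℝ[X]) (a b : ℝ) :
    ∫ x in a..b, (derivative p).eval x = p.eval b - p.eval a :=
  intervalIntegral.integral_eq_sub_of_hasDerivAt (fun x _ => p.hasDerivAt x)
    ((derivative p).continuous.intervalIntegrable _ _)

theorem derivative_mem_degreeLT {r : ℕ} {p : ℝ[X]} (hp : p.degree < (r + 1 : ℕ)) :
    derivative p ∈ degreeLT ℝ r := by
  rw [mem_degreeLT]
  by_cases h0 : p = 0
  · simp [h0]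
  · refine (degree_derivative_lt h0).trans_le ?_
    rw [degree_eq_natDegree h0] at hp ⊢
    exact_mod_cast Nat.lt_succ_iff.1 (by exact_mod_cast hp)

theorem exists_derivative_eq {r : ℕ} {p : ℝ[X]} (hp : p ∈ degreeLT ℝ r) :
    ∃ q : ℝ[X], q.degree < (r + 1 : ℕ) ∧ derivative q = p := by
  refine ⟨∑ n ∈ Finset.range r, monomial (n + 1) (p.coeff n / (n + 1)), ?_, ?_⟩
  · refine (degree_sum_le _ _).trans_lt ?_
    rw [Finset.sup_lt_iff (WithBot.bot_lt_coe _)]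
    intro n hn
    refine (degree_monomial_le _ _).trans_lt ?_
    have := Finset.mem_range.1 hn
    exact_mod_cast Nat.succ_lt_succ this
  · ext n
    rw [derivative_sum, finsetSum_coeff]
    have hn : (n : ℝ) + 1 ≠ 0 := by positivity
    simp only [derivative_monomial, coeff_monomial, Nat.add_sub_cancel, Finset.sum_ite_eq',
      Finset.mem_range, Nat.cast_add, Nat.cast_one]
    split_ifs with h
    · field_simp
    · have := (degree_lt_iff_coeff_zero p r).1 (mem_degreeLT.1 hp) n (not_lt.1 h)
      exact this.symm

/-- The polynomial of degree at most `r` that takes the value `-1/2` at the equidistant nodes to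
the left of the segment `j` and `1/2` at those to its right. Its derivative is dual to the segments;
centring the two values makes its node values as small as possible. -/
noncomputable def stepPoly (r : ℕ) (j : Fin r) : ℝ[X] :=
  Lagrange.interpolate Finset.univ (eqNodes r)
    (fun k => if j.castSucc < k then (1 / 2 : ℝ) else -1 / 2)

theorem stepPoly_eval_eqNodes {r : ℕ} (hr : 1 ≤ r) (j : Fin r) (k : Fin (r + 1)) :
    (stepPoly r j).eval (eqNodes r k) = if j.castSucc < k then (1 / 2 : ℝ) else -1 / 2 :=
  Lagrange.eval_interpolate_at_node _ (eqNodes_injective hr).injOn (Finset.mem_univ k)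

theorem degree_stepPoly_lt {r : ℕ} (hr : 1 ≤ r) (j : Fin r) :
    (stepPoly r j).degree < (r + 1 : ℕ) := by
  have h := Lagrange.degree_interpolate_lt (s := Finset.univ)
    (fun k : Fin (r + 1) => if j.castSucc < k then (1 / 2 : ℝ) else -1 / 2)
    (eqNodes_injective hr).injOn
  rwa [Finset.card_univ, Fintype.card_fin] at h

theorem isSegmentLagrangeBasis_derivative_stepPoly {r : ℕ} (hr : 1 ≤ r) :
    IsSegmentLagrangeBasis (eqLeft r) (eqRight r) (fun j => derivative (stepPoly r j)) := by
  refine ⟨fun j => derivative_mem_degreeLT (degree_stepPoly_lt hr j), fun i j => ?_⟩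
  rw [integral_derivative_eval, eqRight, eqLeft, stepPoly_eval_eqNodes hr, stepPoly_eval_eqNodes hr]
  simp only [Fin.lt_def, Fin.ext_iff, Fin.val_castSucc, Fin.val_succ]
  split_ifs <;> first | omega | norm_num

/-- A polynomial of degree less than `r` is determined by its integrals over the `r` equidistant
segments: a primitive is constant on the `r + 1` nodes. -/
theorem eq_zero_of_integral_eqSegments_eq_zero {r : ℕ} (hr : 1 ≤ r) {p : ℝ[X]}
    (hp : p ∈ degreeLT ℝ r) (h : ∀ i : Fin r, ∫ x in (eqLeft r i)..(eqRight r i), p.eval x = 0) :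
    p = 0 := by
  obtain ⟨q, hq, rfl⟩ := exists_derivative_eq hp
  have hconst : ∀ k : Fin (r + 1), q.eval (eqNodes r k) = q.eval (eqNodes r 0) := by
    intro k
    induction k using Fin.induction with
    | zero => rfl
    | succ i ih =>
      have := h i
      rw [integral_derivative_eval, eqRight, eqLeft] at this
      linarith
  have : q = C (q.eval (eqNodes r 0)) := by
    refine Polynomial.eq_of_degrees_lt_of_eval_index_eq Finset.univ (eqNodes_injective hr).injOn
      (by simpa using hq) ?_ (by simpa using hconst)
    refine degree_C_le.trans_lt ?_
    rw [Finset.card_univ, Fintype.card_fin]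
    exact_mod_cast Nat.succ_pos r
  rw [this, derivative_C]

theorem eq_of_isSegmentLagrangeBasis {r : ℕ} (hr : 1 ≤ r) {ℓ ℓ' : Fin r → ℝ[X]}
    (h : IsSegmentLagrangeBasis (eqLeft r) (eqRight r) ℓ)
    (h' : IsSegmentLagrangeBasis (eqLeft r) (eqRight r) ℓ') : ℓ = ℓ' := by
  funext j
  refine sub_eq_zero.1 (eq_zero_of_integral_eqSegments_eq_zero hr
    (Submodule.sub_mem _ (h.1 j) (h'.1 j)) fun i => ?_)
  simp only [eval_sub]
  rw [intervalIntegral.integral_sub ((ℓ j).continuous.intervalIntegrable _ _)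
    ((ℓ' j).continuous.intervalIntegrable _ _), h.2, h'.2, sub_self]

theorem segmentLagrange_eq {r : ℕ} (hr : 1 ≤ r) (j : Fin r) :
    segmentLagrange (eqLeft r) (eqRight r) j = derivative (stepPoly r j) := by
  have hex : ∃ ℓ, IsSegmentLagrangeBasis (eqLeft r) (eqRight r) ℓ :=
    ⟨_, isSegmentLagrangeBasis_derivative_stepPoly hr⟩
  rw [segmentLagrange, dif_pos hex]
  exact congrFun (eq_of_isSegmentLagrangeBasis hr hex.choose_spec
    (isSegmentLagrangeBasis_derivative_stepPoly hr)) j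

theorem eval_eq_sum_nodalLagrange {r : ℕ} (hr : 1 ≤ r) {q : ℝ[X]} (hq : q.degree < (r + 1 : ℕ))
    (x : ℝ) :
    q.eval x = ∑ k, q.eval (eqNodes r k) * (nodalLagrange (eqNodes r) k).eval x := by
  conv_lhs => rw [Lagrange.eq_interpolate (s := Finset.univ) (v := eqNodes r) (f := q)
    (eqNodes_injective hr).injOn (by simpa using hq)]
  simp [Lagrange.interpolate_apply, eval_finsetSum, nodalLagrange]

theorem degree_nodalLagrange_lt {r : ℕ} (hr : 1 ≤ r) (k : Fin (r + 1)) :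
    (nodalLagrange (eqNodes r) k).degree < (r + 1 : ℕ) := by
  rw [nodalLagrange, Lagrange.degree_basis (eqNodes_injective hr).injOn (Finset.mem_univ k)]
  simp only [Finset.card_univ, Fintype.card_fin, Nat.add_sub_cancel]
  exact_mod_cast Nat.lt_succ_self r

theorem nodalLagrange_eval_eqNodes {r : ℕ} (hr : 1 ≤ r) (k m : Fin (r + 1)) :
    (nodalLagrange (eqNodes r) k).eval (eqNodes r m) = if k = m then 1 else 0 := by
  split_ifs with h
  · subst h
    exact Lagrange.eval_basis_self (eqNodes_injective hr).injOn (Finset.mem_univ k)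
  · exact Lagrange.eval_basis_of_ne h (Finset.mem_univ m)

/-- Segmental interpolation reproduces the derivatives of the nodal Lagrange polynomials. -/
theorem derivative_nodalLagrange_eq {r : ℕ} (hr : 1 ≤ r) (k : Fin (r + 1)) :
    derivative (nodalLagrange (eqNodes r) k) =
      ∑ j : Fin r, C ((if k = j.succ then (1 : ℝ) else 0) - if k = j.castSucc then 1 else 0) *
        derivative (stepPoly r j) := by
  have hb := isSegmentLagrangeBasis_derivative_stepPoly hr
  refine sub_eq_zero.1 (eq_zero_of_integral_eqSegments_eq_zero hr (Submodule.sub_mem _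
    (derivative_mem_degreeLT (degree_nodalLagrange_lt hr k)) (Submodule.sum_mem _ fun j _ => ?_))
    fun i => ?_)
  · rw [← smul_eq_C_mul]
    exact Submodule.smul_mem _ _ (hb.1 j)
  · simp only [eval_sub, eval_finsetSum, eval_mul, eval_C]
    rw [intervalIntegral.integral_sub (Polynomial.continuous _ |>.intervalIntegrable _ _)
      (Continuous.intervalIntegrable (by fun_prop) _ _), integral_derivative_eval,
      intervalIntegral.integral_finsetSum
        fun j _ => Continuous.intervalIntegrable (by fun_prop) _ _]
    simp only [intervalIntegral.integral_const_mul, hb.2]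
    simp only [eqRight, eqLeft, nodalLagrange_eval_eqNodes hr]
    simp

/-! ### Segmental interpolation of a derivative -/

theorem hasDerivAt_nodalInterp {r : ℕ} (hr : 1 ≤ r) {f f' : ℝ → ℂ}
    (hf : ∀ x ∈ Icc (-1 : ℝ) 1, HasDerivWithinAt f (f' x) (Icc (-1) 1) x)
    (hint : IntervalIntegrable f' volume (-1) 1) (x : ℝ) :
    HasDerivAt (nodalInterp (eqNodes r) f) (segmentInterp (eqLeft r) (eqRight r) f' x) x := by
  have hseg : ∀ j : Fin r, ∫ t in (eqLeft r j)..(eqRight r j), f' t =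
      f (eqNodes r j.succ) - f (eqNodes r j.castSucc) := by
    intro j
    have hsub : Icc (eqLeft r j) (eqRight r j) ⊆ Icc (-1) 1 :=
      Icc_subset_Icc (eqNodes_mem_Icc hr _).1 (eqNodes_mem_Icc hr _).2
    refine intervalIntegral.integral_eq_sub_of_hasDerivAt_of_le (eqLeft_le_eqRight j)
      (fun y hy => ((hf y (hsub hy)).continuousWithinAt).mono hsub) (fun y hy => ?_)
      (hint.mono_set ?_)
    · have hy' : y ∈ Ioo (-1 : ℝ) 1 :=
        ⟨(eqNodes_mem_Icc hr _).1.trans_lt hy.1, hy.2.trans_le (eqNodes_mem_Icc hr _).2⟩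
      exact (hf y (Ioo_subset_Icc_self hy')).hasDerivAt (Icc_mem_nhds hy'.1 hy'.2)
    · rw [uIcc_of_le (eqLeft_le_eqRight j), uIcc_of_le (by norm_num)]
      exact hsub
  have hd : HasDerivAt (nodalInterp (eqNodes r) f)
      (∑ k, f (eqNodes r k) *
        (((derivative (nodalLagrange (eqNodes r) k)).eval x : ℝ) : ℂ)) x := by
    unfold nodalInterp
    refine HasDerivAt.fun_sum fun k _ => ?_
    exact ((Polynomial.hasDerivAt _ x).ofReal_comp).const_mul _
  convert hd using 1
  simp only [segmentInterp, hseg, segmentLagrange_eq hr, derivative_nodalLagrange_eq hr,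
    eval_finsetSum, eval_mul, eval_C, Complex.ofReal_sum, Complex.ofReal_mul, Finset.mul_sum]
  rw [Finset.sum_comm]
  refine Finset.sum_congr rfl fun j _ => ?_
  simp only [← mul_assoc, ← Finset.sum_mul]
  congr 1
  simp [mul_sub, apply_ite Complex.ofReal]

/-! ### Markov's inequality and the upper bound by the nodal Lebesgue constant -/

theorem degree_C_mul_le (a : ℝ) (p : ℝ[X]) : (C a * p).degree ≤ p.degree := by
  rw [← smul_eq_C_mul]
  exact degree_smul_le a p

/-- The endpoint case of Markov's inequality, from `T_n'(1) = n ^ 2` and the extremality of the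
Chebyshev polynomial `T_n`. -/
theorem derivative_eval_one_le {n : ℕ} {P : ℝ[X]} {M : ℝ} (hM : 0 < M) (hdeg : P.degree ≤ n)
    (hP : ∀ x ∈ Icc (-1 : ℝ) 1, |P.eval x| ≤ M) : (derivative P).eval 1 ≤ n ^ 2 * M := by
  have h := Chebyshev.eval_iterate_derivative_le_of_forall_abs_le_one (n := n) (k := 1)
    (P := C M⁻¹ * P) (x := 1) le_rfl ((degree_C_mul_le _ _).trans hdeg) (fun x hx => by
      rw [eval_mul, eval_C, abs_mul, abs_of_pos (inv_pos.2 hM), inv_mul_le_iff₀ hM, mul_one]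
      exact hP x hx)
  have hT := Chebyshev.iterate_derivative_T_eval_one_recurrence (R := ℝ) n 0
  simp only [Nat.cast_zero, mul_zero, zero_add, one_mul, Function.iterate_one,
    Function.iterate_zero, id, Chebyshev.T_eval_one, mul_one, Int.cast_natCast] at hT
  simp only [Function.iterate_one, derivative_C_mul, eval_mul, eval_C, hT] at h
  rw [inv_mul_le_iff₀ hM] at h
  linarith

/-- **Markov's inequality** with an additional factor `2`: it reduces to the value of the
derivative at an endpoint by mapping `[-1, 1]` onto the longer one of `[-1, x]` and `[x, 1]`. -/
theorem abs_derivative_eval_le {n : ℕ} {P : ℝ[X]} {M : ℝ} (hM : 0 < M) (hdeg : P.degree ≤ n)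
    (hP : ∀ x ∈ Icc (-1 : ℝ) 1, |P.eval x| ≤ M) {x : ℝ} (hx : x ∈ Icc (-1 : ℝ) 1) :
    |(derivative P).eval x| ≤ 2 * n ^ 2 * M := by
  obtain ⟨c, hc, hxc⟩ : ∃ c ∈ Icc (-1 : ℝ) 1, 1 ≤ |x - c| := by
    rcases le_total 0 x with h | h
    · exact ⟨-1, by simp, by rw [le_abs]; left; linarith⟩
    · exact ⟨1, by simp, by rw [le_abs]; right; linarith⟩
  have key : ∀ Q : ℝ[X], Q.degree ≤ n → (∀ x ∈ Icc (-1 : ℝ) 1, |Q.eval x| ≤ M) →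
      (derivative Q).eval x * ((x - c) / 2) ≤ n ^ 2 * M := by
    intro Q hdeg hQ
    have hlin : natDegree (C ((x + c) / 2) + C ((x - c) / 2) * X) ≤ 1 := by compute_degree
    have h := derivative_eval_one_le (P := Q.comp (C ((x + c) / 2) + C ((x - c) / 2) * X)) hM
      (degree_le_of_natDegree_le (natDegree_comp_le.trans
        ((Nat.mul_le_mul (natDegree_le_of_degree_le hdeg) hlin).trans (mul_one n).le)))
      (fun y hy => ?_)
    · simp only [derivative_comp, eval_mul, eval_comp, eval_add, eval_C, eval_X, derivative_add,
        derivative_C, derivative_C_mul, derivative_X, mul_one, zero_add] at h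
      have hpt : (x + c) / 2 + (x - c) / 2 = x := by ring
      rw [hpt] at h
      linarith
    · simp only [eval_comp, eval_add, eval_C, eval_mul, eval_X]
      refine hQ _ ?_
      have : (x + c) / 2 + (x - c) / 2 * y = (1 + y) / 2 * x + (1 - y) / 2 * c := by ring
      rw [this]
      have h1 : 0 ≤ (1 + y) / 2 := by linarith [hy.1]
      have h2 : 0 ≤ (1 - y) / 2 := by linarith [hy.2]
      exact (convex_Icc (-1 : ℝ) 1) hx hc h1 h2 (by ring)
  have h1 := key P hdeg hP
  have h2 := key (-P) (by rwa [degree_neg]) (fun x hx => by rw [eval_neg, abs_neg]; exact hP x hx)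
  rw [derivative_neg, eval_neg] at h2
  have h3 : |(derivative P).eval x| * |x - c| ≤ 2 * n ^ 2 * M := by
    rw [← abs_mul, abs_le]
    constructor <;> linarith
  exact (le_mul_of_one_le_right (abs_nonneg _) hxc).trans h3

theorem continuous_sum_abs_nodalLagrange {n : ℕ} (ξ : Fin n → ℝ) :
    Continuous fun x : ℝ => ∑ i, |(nodalLagrange ξ i).eval x| :=
  continuous_finsetSum _ fun i _ => (nodalLagrange ξ i).continuous.abs

theorem sum_abs_nodalLagrange_le {n : ℕ} (ξ : Fin n → ℝ) {x : ℝ} (hx : x ∈ Icc (-1 : ℝ) 1) :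
    ∑ i, |(nodalLagrange ξ i).eval x| ≤ nodalLebesgue ξ :=
  le_csSup (isCompact_Icc.image (continuous_sum_abs_nodalLagrange ξ)).bddAbove ⟨x, hx, rfl⟩

theorem sum_abs_segmentLagrange_le {r : ℕ} {α β : Fin r → ℝ} (h : ∀ i, α i ≤ β i) {x : ℝ}
    (hx : x ∈ Icc (-1 : ℝ) 1) :
    ∑ i, (β i - α i) * |(segmentLagrange α β i).eval x| ≤ segmentLebesgue α β := by
  rw [segmentLebesgue_eq_pointwise α β h]
  refine le_csSup (isCompact_Icc.image ?_).bddAbove ⟨x, hx, rfl⟩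
  exact continuous_finsetSum _ fun i _ => continuous_const.mul (Polynomial.continuous _).abs

theorem one_le_nodalLebesgue {r : ℕ} (hr : 1 ≤ r) : 1 ≤ nodalLebesgue (eqNodes r) := by
  have h := sum_abs_nodalLagrange_le (eqNodes r) (eqNodes_mem_Icc hr 0)
  simpa [nodalLagrange_eval_eqNodes hr, apply_ite abs] using h

/-- With the right signs, the value at `x` of the segmental Lebesgue function is that of the
derivative of a combination of step polynomials whose node values are at most `1` in size. -/
theorem segmentLebesgue_le_mul_nodalLebesgue {r : ℕ} (hr : 1 ≤ r) :
    segmentLebesgue (eqLeft r) (eqRight r) ≤ 2 * (r : ℝ) ^ 2 * nodalLebesgue (eqNodes r) := by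
  have hr0 : (0 : ℝ) < r := by positivity
  rw [segmentLebesgue_eq_pointwise _ _ eqLeft_le_eqRight]
  refine csSup_le ⟨_, 0, by simp, rfl⟩ ?_
  rintro _ ⟨x, hx, rfl⟩
  -- The signs turn the sum of absolute values into the value of one derivative.
  let ε : Fin r → ℝ := fun j => SignType.sign ((derivative (stepPoly r j)).eval x)
  have hε : ∀ j, |ε j| ≤ 1 := fun j => by
    simp only [ε]
    rcases lt_trichotomy ((derivative (stepPoly r j)).eval x) 0 with h | h | h <;> simp [h]
  let P : ℝ[X] := ∑ j, C (2 / r * ε j) * stepPoly r j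
  have hPlt : P.degree < (r + 1 : ℕ) := by
    refine (degree_sum_le _ _).trans_lt ?_
    rw [Finset.sup_lt_iff (WithBot.bot_lt_coe _)]
    exact fun j _ => (degree_C_mul_le _ _).trans_lt (degree_stepPoly_lt hr j)
  have hPdeg : P.degree ≤ r := by
    refine (degree_le_iff_coeff_zero P r).2 fun m hm => ?_
    exact (degree_lt_iff_coeff_zero P _).1 hPlt m (by exact_mod_cast hm)
  have hPnode : ∀ k, |P.eval (eqNodes r k)| ≤ 1 := by
    intro k
    simp only [P, eval_finsetSum, eval_mul, eval_C]
    calc _ ≤ ∑ j : Fin r, |2 / r * ε j * (stepPoly r j).eval (eqNodes r k)| :=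
          Finset.abs_sum_le_sum_abs _ _
      _ ≤ ∑ j : Fin r, 1 / (r : ℝ) := by
          refine Finset.sum_le_sum fun j _ => ?_
          have hs : |(stepPoly r j).eval (eqNodes r k)| = 1 / 2 := by
            rw [stepPoly_eval_eqNodes hr]
            split_ifs <;> norm_num [abs_div]
          rw [abs_mul, abs_mul, hs, abs_of_pos (by positivity : (0 : ℝ) < 2 / r)]
          calc 2 / (r : ℝ) * |ε j| * (1 / 2) ≤ 2 / (r : ℝ) * 1 * (1 / 2) := by
                gcongr
                exact hε j
            _ = 1 / r := by ring
      _ = 1 := by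
          rw [Finset.sum_const, Finset.card_univ, Fintype.card_fin, nsmul_eq_mul]
          field_simp
  have hP : ∀ y ∈ Icc (-1 : ℝ) 1, |P.eval y| ≤ nodalLebesgue (eqNodes r) := by
    intro y hy
    rw [eval_eq_sum_nodalLagrange hr hPlt y]
    refine (Finset.abs_sum_le_sum_abs _ _).trans
      (le_trans (Finset.sum_le_sum fun k _ => ?_) (sum_abs_nodalLagrange_le _ hy))
    rw [abs_mul]
    exact mul_le_of_le_one_left (abs_nonneg _) (hPnode k)
  have hval : ∑ j, (eqRight r j - eqLeft r j) *
      |(segmentLagrange (eqLeft r) (eqRight r) j).eval x| = (derivative P).eval x := by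
    simp only [P, derivative_sum, derivative_C_mul, eval_finsetSum, eval_mul, eval_C]
    refine Finset.sum_congr rfl fun j _ => ?_
    rw [eqRight_sub_eqLeft, segmentLagrange_eq hr, mul_assoc, sign_mul_self]
  simp only [hval]
  exact (le_abs_self _).trans (abs_derivative_eval_le
    (zero_lt_one.trans_le (one_le_nodalLebesgue hr)) hPdeg hP hx)

/-! ### The lower bound -/

/-- The derivative of a Lagrange polynomial at another node. -/
theorem derivative_basis_eval_of_ne {ι F : Type*} [DecidableEq ι] [Field F] {s : Finset ι}
    {v : ι → F} {i j : ι} (hij : i ≠ j) (hj : j ∈ s) :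
    (derivative (Lagrange.basis s v i)).eval (v j) =
      (v i - v j)⁻¹ * ∏ m ∈ (s.erase i).erase j, (v i - v m)⁻¹ * (v j - v m) := by
  rw [Lagrange.basis, ← Finset.mul_prod_erase (s.erase i) _ (Finset.mem_erase.2 ⟨hij.symm, hj⟩),
    derivative_mul, eval_add, eval_mul, eval_mul, Lagrange.eval_basisDivisor_right, zero_mul,
    add_zero, eval_prod]
  simp [Lagrange.basisDivisor]

theorem prod_range_sub_eq_factorial (n : ℕ) :
    ∏ j ∈ Finset.range n, ((n : ℝ) - (j : ℝ)) = n.factorial := by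
  rw [← Finset.prod_range_add_one_eq_factorial, ← Finset.prod_range_reflect, Nat.cast_prod]
  refine Finset.prod_congr rfl fun j hj => ?_
  have := Finset.mem_range.1 hj
  rw [← Nat.cast_sub (by omega)]
  congr 1
  omega

theorem prod_abs_sub_eq {r : ℕ} (k : Fin (r + 1)) :
    ∏ j ∈ Finset.univ.erase k, |(k : ℝ) - (j : ℝ)| =
      (k : ℕ).factorial * (r - (k : ℕ)).factorial := by
  let g : ℕ → ℝ := fun j => if j = (k : ℕ) then 1 else |(k : ℝ) - (j : ℝ)|
  have h1 : ∏ j ∈ Finset.univ.erase k, |(k : ℝ) - (j : ℝ)| = ∏ j : Fin (r + 1), g j := by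
    rw [← Finset.prod_erase Finset.univ (a := k) (by simp [g])]
    refine Finset.prod_congr rfl fun j hj => ?_
    have : (j : ℕ) ≠ k := fun h => Finset.ne_of_mem_erase hj (Fin.ext h)
    simp [g, this]
  have hk : (k : ℕ) ≤ r := Nat.lt_succ_iff.1 k.2
  have hsplit : Finset.range (r + 1) = Finset.range ((k : ℕ) + (r - (k : ℕ) + 1)) := by
    congr 1
    omega
  rw [h1, Fin.prod_univ_eq_prod_range g, hsplit, Finset.prod_range_add, Finset.prod_range_succ']
  have h2 : ∏ j ∈ Finset.range (k : ℕ), g j = (k : ℕ).factorial := by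
    rw [← prod_range_sub_eq_factorial]
    refine Finset.prod_congr rfl fun j hj => ?_
    have hj := Finset.mem_range.1 hj
    have : (j : ℝ) ≤ (k : ℕ) := by exact_mod_cast hj.le
    simp only [g, if_neg hj.ne]
    exact abs_of_nonneg (by linarith)
  have h3 : ∏ i ∈ Finset.range (r - (k : ℕ)), g ((k : ℕ) + (i + 1)) =
      (r - (k : ℕ)).factorial := by
    rw [← Finset.prod_range_add_one_eq_factorial, Nat.cast_prod]
    refine Finset.prod_congr rfl fun i _ => ?_
    have : (k : ℕ) + (i + 1) ≠ k := by omega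
    simp only [g, if_neg this]
    push_cast
    rw [show (k : ℝ) - ((k : ℝ) + ((i : ℝ) + 1)) = -((i : ℝ) + 1) by ring, abs_neg,
      abs_of_nonneg (by positivity)]
  rw [h2, h3]
  simp [g]

theorem eqNodes_sub_eqNodes {r : ℕ} (i j : Fin (r + 1)) :
    eqNodes r i - eqNodes r j = 2 / r * ((i : ℝ) - (j : ℝ)) := by
  unfold eqNodes
  ring

theorem abs_derivative_nodalLagrange_eval {r : ℕ} (hr : 1 ≤ r) {k : Fin (r + 1)} (hk : k ≠ 0) :
    |(derivative (nodalLagrange (eqNodes r) k)).eval (eqNodes r 0)| =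
      r / (2 * (k : ℕ)) * (r.choose k : ℝ) := by
  have hr0 : (0 : ℝ) < r := by positivity
  have hk0 : (0 : ℝ) < (k : ℕ) := by
    exact_mod_cast Nat.pos_of_ne_zero fun h => hk (Fin.ext h)
  have hkr : (k : ℕ) ≤ r := Nat.lt_succ_iff.1 k.2
  set s := (Finset.univ.erase k).erase (0 : Fin (r + 1)) with hs
  have hA : (k : ℕ) * ∏ m ∈ s, |(k : ℝ) - (m : ℝ)| =
      (k : ℕ).factorial * (r - (k : ℕ)).factorial := by
    rw [← prod_abs_sub_eq k, ← Finset.mul_prod_erase (Finset.univ.erase k)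
      (fun m : Fin (r + 1) => |(k : ℝ) - (m : ℝ)|)
      (Finset.mem_erase.2 ⟨hk.symm, Finset.mem_univ _⟩)]
    simp [hs]
  have hB : (k : ℕ) * ∏ m ∈ s, |((0 : Fin (r + 1)) : ℝ) - (m : ℝ)| = r.factorial := by
    have h := prod_abs_sub_eq (0 : Fin (r + 1))
    rw [← Finset.mul_prod_erase (Finset.univ.erase 0) _
      (Finset.mem_erase.2 ⟨hk, Finset.mem_univ k⟩), Finset.erase_right_comm] at h
    simpa [hs] using h
  have hfac : ((r.choose k : ℕ) : ℝ) * (k : ℕ).factorial * (r - (k : ℕ)).factorial =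
      r.factorial := by exact_mod_cast Nat.choose_mul_factorial_mul_factorial hkr
  have hprod : ∏ m ∈ s, |(eqNodes r k - eqNodes r m)⁻¹ * (eqNodes r 0 - eqNodes r m)| =
      r.choose k := by
    have : ∀ m ∈ s, |(eqNodes r k - eqNodes r m)⁻¹ * (eqNodes r 0 - eqNodes r m)| =
        |((0 : Fin (r + 1)) : ℝ) - (m : ℝ)| / |(k : ℝ) - (m : ℝ)| := by
      intro m _
      rw [eqNodes_sub_eqNodes, eqNodes_sub_eqNodes, inv_mul_eq_div,
        mul_div_mul_left _ _ (by positivity), abs_div]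
    rw [Finset.prod_congr rfl this, Finset.prod_div_distrib]
    have hA0 : ∏ m ∈ s, |(k : ℝ) - (m : ℝ)| ≠ 0 := by
      intro h0
      rw [h0, mul_zero] at hA
      have : (0 : ℝ) < (k : ℕ).factorial * (r - (k : ℕ)).factorial := by positivity
      exact this.ne hA
    rw [div_eq_iff hA0]
    refine mul_left_cancel₀ hk0.ne' ?_
    rw [hB, ← hfac, mul_left_comm, hA, mul_assoc]
  rw [nodalLagrange, derivative_basis_eval_of_ne hk (Finset.mem_univ _), abs_mul, Finset.abs_prod,
    hprod, eqNodes_sub_eqNodes]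
  simp only [Fin.val_zero, Nat.cast_zero, sub_zero]
  rw [abs_of_pos (by positivity)]
  field_simp

/-- The derivatives at the left endpoint of the nodal Lagrange polynomials are differences of
adjacent segmental ones, and they add up to about `2 ^ r`. -/
theorem lt_segmentLebesgue {r : ℕ} (hr : 1 ≤ r) :
    1 / Real.pi * ((2 : ℝ) ^ (r - 1) / (r : ℝ) ^ 2) < segmentLebesgue (eqLeft r) (eqRight r) := by
  have hr0 : (0 : ℝ) < r := by positivity
  set w : Fin r → ℝ := fun j => |(derivative (stepPoly r j)).eval (eqNodes r 0)| with hw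
  have hΛ : 2 / r * ∑ j, w j ≤ segmentLebesgue (eqLeft r) (eqRight r) := by
    have h := sum_abs_segmentLagrange_le (α := eqLeft r) (β := eqRight r) eqLeft_le_eqRight
      (eqNodes_mem_Icc hr 0)
    simpa only [eqRight_sub_eqLeft, segmentLagrange_eq hr, ← Finset.mul_sum] using h
  have hupper : ∑ k, |(derivative (nodalLagrange (eqNodes r) k)).eval (eqNodes r 0)| ≤
      2 * ∑ j, w j := by
    calc _ ≤ ∑ k : Fin (r + 1), ∑ j : Fin r,
          ((if k = j.succ then (1 : ℝ) else 0) + if k = j.castSucc then 1 else 0) * w j := by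
          refine Finset.sum_le_sum fun k _ => ?_
          rw [derivative_nodalLagrange_eq hr, eval_finsetSum]
          refine (Finset.abs_sum_le_sum_abs _ _).trans (Finset.sum_le_sum fun j _ => ?_)
          rw [eval_mul, eval_C, abs_mul]
          refine mul_le_mul_of_nonneg_right ?_ (abs_nonneg _)
          split_ifs <;> norm_num
      _ = 2 * ∑ j, w j := by
          rw [Finset.sum_comm, Finset.mul_sum]
          refine Finset.sum_congr rfl fun j _ => ?_
          rw [← Finset.sum_mul, Finset.sum_add_distrib]
          simp only [Finset.sum_ite_eq', Finset.mem_univ, if_true]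
          norm_num
  have hlower : ((2 : ℝ) ^ r - 1) / 2 ≤
      ∑ k, |(derivative (nodalLagrange (eqNodes r) k)).eval (eqNodes r 0)| := by
    rw [Fin.sum_univ_succ]
    refine le_add_of_nonneg_of_le (abs_nonneg _) ?_
    have hsum : ∑ i : Fin r, (r.choose (i + 1) : ℝ) = 2 ^ r - 1 := by
      have h := Nat.sum_range_choose r
      rw [Finset.sum_range_succ', Nat.choose_zero_right] at h
      rw [Fin.sum_univ_eq_sum_range (fun i => (r.choose (i + 1) : ℝ)), eq_sub_iff_add_eq]
      exact_mod_cast h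
    rw [← hsum, Finset.sum_div]
    refine Finset.sum_le_sum fun i _ => ?_
    rw [abs_derivative_nodalLagrange_eval hr (Fin.succ_ne_zero i), Fin.val_succ, div_eq_inv_mul]
    refine mul_le_mul_of_nonneg_right ?_ (Nat.cast_nonneg _)
    have : (((i : ℕ) + 1 : ℕ) : ℝ) ≤ r := by exact_mod_cast i.2
    rw [le_div_iff₀ (by positivity)]
    linarith
  have hpow : (2 : ℝ) ^ r = 2 * 2 ^ (r - 1) := by
    rw [← pow_succ', Nat.sub_add_cancel hr]
  have hone : (1 : ℝ) ≤ 2 ^ (r - 1) := one_le_pow₀ (by norm_num)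
  have hr1 : (1 : ℝ) ≤ r := by exact_mod_cast hr
  have hpi : 1 / Real.pi < 1 / 2 :=
    one_div_lt_one_div_of_lt (by norm_num) (by linarith [Real.pi_gt_three])
  calc 1 / Real.pi * ((2 : ℝ) ^ (r - 1) / (r : ℝ) ^ 2)
      < 1 / 2 * ((2 : ℝ) ^ (r - 1) / (r : ℝ) ^ 2) := by gcongr
    _ ≤ 1 / 2 * ((2 : ℝ) ^ (r - 1) / r) := by
        gcongr
        exact le_self_pow₀ hr1 (by norm_num)
    _ ≤ 2 / r * (((2 : ℝ) ^ r - 1) / 2 / 2) := by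
        rw [hpow, div_mul_div_comm, div_mul_eq_mul_div, one_mul]
        rw [div_le_div_iff₀ (by positivity) hr0]
        nlinarith
    _ ≤ 2 / r * ∑ j, w j := by
        gcongr
        linarith
    _ ≤ _ := hΛ

/-! ### The nodal Lebesgue constant of the equidistant nodes -/

theorem abs_nodalLagrange_eval {r : ℕ} (hr : 1 ≤ r) (k : Fin (r + 1)) (t : ℝ) :
    |(nodalLagrange (eqNodes r) k).eval (-1 + 2 * t / r)| =
      (∏ j ∈ Finset.univ.erase k, |t - (j : ℝ)|) /
        ((k : ℕ).factorial * (r - (k : ℕ)).factorial) := by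
  have hr0 : (0 : ℝ) < r := by positivity
  rw [← prod_abs_sub_eq k, ← Finset.prod_div_distrib, nodalLagrange, Lagrange.basis, eval_prod,
    Finset.abs_prod]
  refine Finset.prod_congr rfl fun j _ => ?_
  have h1 : -1 + 2 * t / r - eqNodes r j = 2 / r * (t - (j : ℝ)) := by
    unfold eqNodes
    ring
  rw [Lagrange.basisDivisor, eval_mul, eval_C, eval_sub, eval_X, eval_C, h1, eqNodes_sub_eqNodes,
    inv_mul_eq_div, mul_div_mul_left _ _ (by positivity), abs_div]

/-- The distance from the integer `j` to the farther endpoint of `[m, m + 1]`. -/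
noncomputable def farDist (m j : ℕ) : ℝ := if j ≤ m then (m : ℝ) + 1 - j else (j : ℝ) - m

theorem one_le_farDist (m j : ℕ) : 1 ≤ farDist m j := by
  unfold farDist
  split_ifs with h
  · have : (j : ℝ) ≤ m := by exact_mod_cast h
    linarith
  · have : (m : ℝ) + 1 ≤ j := by exact_mod_cast not_le.1 h
    linarith

theorem abs_sub_le_farDist {m j : ℕ} {t : ℝ} (ht : t ∈ Icc (m : ℝ) (m + 1)) :
    |t - j| ≤ farDist m j := by
  have h1 := ht.1
  have h2 := ht.2
  unfold farDist
  split_ifs with h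
  · have : (j : ℝ) ≤ m := by exact_mod_cast h
    rw [abs_of_nonneg] <;> linarith
  · have : (m : ℝ) + 1 ≤ j := by exact_mod_cast not_le.1 h
    rw [abs_of_nonpos] <;> linarith

theorem prod_farDist {r m : ℕ} (hm : m ≤ r) :
    ∏ j : Fin (r + 1), farDist m j = (m + 1).factorial * (r - m).factorial := by
  rw [Fin.prod_univ_eq_prod_range (farDist m), show r + 1 = (m + 1) + (r - m) by omega,
    Finset.prod_range_add]
  congr 1
  · rw [← prod_range_sub_eq_factorial]
    refine Finset.prod_congr rfl fun j hj => ?_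
    rw [farDist, if_pos (Nat.lt_succ_iff.1 (Finset.mem_range.1 hj)), Nat.cast_add, Nat.cast_one]
  · rw [← Finset.prod_range_add_one_eq_factorial, Nat.cast_prod]
    refine Finset.prod_congr rfl fun i _ => ?_
    rw [farDist, if_neg (by omega)]
    push_cast
    ring

theorem abs_nodalLagrange_eval_le {r m : ℕ} (hr : 1 ≤ r) (hm : m ≤ r) (k : Fin (r + 1)) {t : ℝ}
    (ht : t ∈ Icc (m : ℝ) (m + 1)) :
    |(nodalLagrange (eqNodes r) k).eval (-1 + 2 * t / r)| ≤
      ((m + 1).factorial * (r - m).factorial : ℝ) / r.factorial *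
        (r.choose k / farDist m k) := by
  have hk : (k : ℕ) ≤ r := Nat.lt_succ_iff.1 k.2
  have hd : 0 < farDist m k := zero_lt_one.trans_le (one_le_farDist m k)
  have hfac : (r.factorial : ℝ) = ((r.choose k : ℕ) : ℝ) * (k : ℕ).factorial *
      (r - (k : ℕ)).factorial := by
    exact_mod_cast (Nat.choose_mul_factorial_mul_factorial hk).symm
  have hc : (0 : ℝ) < r.choose k := by exact_mod_cast Nat.choose_pos hk
  have hprod : ∏ j ∈ Finset.univ.erase k, |t - (j : ℝ)| ≤
      ((m + 1).factorial * (r - m).factorial : ℝ) / farDist m k := by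
    rw [le_div_iff₀ hd, ← prod_farDist hm, mul_comm,
      ← Finset.mul_prod_erase Finset.univ (fun j : Fin (r + 1) => farDist m j) (Finset.mem_univ k)]
    refine mul_le_mul_of_nonneg_left ?_ hd.le
    exact Finset.prod_le_prod (fun j _ => abs_nonneg _) fun j _ => abs_sub_le_farDist ht
  rw [abs_nodalLagrange_eval hr]
  calc _ ≤ ((m + 1).factorial * (r - m).factorial : ℝ) / farDist m k /
        ((k : ℕ).factorial * (r - (k : ℕ)).factorial) := by gcongr
    _ = _ := by
        rw [hfac]
        field_simp

theorem factorial_mul_factorial_le {a b : ℕ} (ha : 2 ≤ a) (hb : 2 ≤ b) :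
    a.factorial * b.factorial ≤ 2 * (a + b - 2).factorial := by
  induction a, ha using Nat.le_induction with
  | base => simp
  | succ a ha ih =>
    rw [show a + 1 + b - 2 = (a + b - 2) + 1 by omega, Nat.factorial_succ, Nat.factorial_succ]
    calc (a + 1) * a.factorial * b.factorial = (a + 1) * (a.factorial * b.factorial) := by ring
      _ ≤ (a + b - 2 + 1) * (2 * (a + b - 2).factorial) := Nat.mul_le_mul (by omega) ih
      _ = _ := by ring

theorem sum_choose_real (n : ℕ) : ∑ k : Fin (n + 1), (n.choose k : ℝ) = 2 ^ n := by
  rw [Fin.sum_univ_eq_sum_range (fun k => (n.choose k : ℝ))]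
  exact_mod_cast Nat.sum_range_choose n

/-- In the first cell of the grid the distances to the nodes provide a factor of order `1 / r`. -/
theorem sum_choose_div_farDist_zero_le (r : ℕ) :
    ∑ k : Fin (r + 1), (r.choose k : ℝ) / farDist 0 k ≤ 2 ^ (r + 2) / (r + 1) := by
  have hterm : ∀ k : Fin (r + 1), (r.choose k : ℝ) / farDist 0 k ≤
      2 / (r + 1) * ((r + 1).choose (k + 1) : ℝ) := by
    intro k
    have hd : ((k : ℕ) : ℝ) + 1 ≤ 2 * farDist 0 k := by
      unfold farDist
      split_ifs with h
      · rw [Nat.le_zero.1 h]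
        norm_num
      · have : (1 : ℝ) ≤ (k : ℕ) := by exact_mod_cast Nat.pos_of_ne_zero fun h0 => h h0.le
        push_cast
        linarith
    have hc : ((r : ℝ) + 1) * r.choose k = (r + 1).choose (k + 1) * ((k : ℕ) + 1) := by
      exact_mod_cast Nat.add_one_mul_choose_eq r k
    have h0 := one_le_farDist 0 k
    rw [div_le_iff₀ (by linarith), div_mul_eq_mul_div, div_mul_eq_mul_div,
      le_div_iff₀ (by positivity), mul_comm _ ((r : ℝ) + 1), hc]
    nlinarith [Nat.cast_nonneg (α := ℝ) ((r + 1).choose (k + 1))]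
  refine (Finset.sum_le_sum fun k _ => hterm k).trans ?_
  rw [← Finset.mul_sum]
  have hsum : ∑ k : Fin (r + 1), ((r + 1).choose (k + 1) : ℝ) ≤ 2 ^ (r + 1) := by
    rw [← sum_choose_real, Fin.sum_univ_succ (n := r + 1)]
    exact le_add_of_nonneg_left (Nat.cast_nonneg _)
  calc _ ≤ 2 / ((r : ℝ) + 1) * 2 ^ (r + 1) := by gcongr
    _ = _ := by ring

/-- The reflection `j ↦ r - j` exchanges the last cell with the first one. -/
theorem sum_choose_div_farDist_last {r m : ℕ} (hm : m + 1 = r) :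
    ∑ k : Fin (r + 1), (r.choose k : ℝ) / farDist m k =
      ∑ k : Fin (r + 1), (r.choose k : ℝ) / farDist 0 k := by
  rw [← Equiv.sum_comp Fin.revPerm]
  refine Finset.sum_congr rfl fun k _ => ?_
  have hk : (k : ℕ) ≤ r := Nat.lt_succ_iff.1 k.2
  have hv : ((Fin.revPerm k : Fin (r + 1)) : ℕ) = r - k := by
    rw [Fin.revPerm_apply, Fin.val_rev]
    omega
  have hmr : (m : ℝ) + 1 = r := by exact_mod_cast hm
  rw [hv, Nat.choose_symm hk]
  congr 1
  unfold farDist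
  rw [Nat.cast_sub hk]
  split_ifs with h1 h2 h2
  · rw [Nat.le_zero.1 h2] at h1
    omega
  · push_cast
    linarith
  · rw [Nat.le_zero.1 h2]
    push_cast
    linarith
  · omega

theorem nodalLebesgue_eqNodes_le {r : ℕ} (hr : 1 ≤ r) :
    nodalLebesgue (eqNodes r) ≤ 2 ^ (r + 2) / r := by
  have hr0 : (0 : ℝ) < r := by positivity
  refine csSup_le ⟨_, 0, by simp, rfl⟩ ?_
  rintro _ ⟨x, hx, rfl⟩
  obtain ⟨t, ht0, htr, rfl⟩ : ∃ t : ℝ, 0 ≤ t ∧ t ≤ r ∧ x = -1 + 2 * t / r := by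
    refine ⟨(x + 1) * r / 2, ?_, ?_, ?_⟩
    · have := hx.1
      have : 0 ≤ x + 1 := by linarith
      positivity
    · nlinarith [hx.2]
    · field_simp
      ring
  obtain ⟨m, hm, htm⟩ : ∃ m : ℕ, m + 1 ≤ r ∧ t ∈ Icc (m : ℝ) (m + 1) := by
    rcases htr.eq_or_lt with h | h
    · refine ⟨r - 1, by omega, ?_⟩
      rw [Nat.cast_sub hr, h]
      constructor <;> norm_num
    · exact ⟨⌊t⌋₊, (Nat.floor_lt ht0).2 h, Nat.floor_le ht0, (Nat.lt_floor_add_one t).le⟩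
  refine (Finset.sum_le_sum fun k _ => abs_nodalLagrange_eval_le hr (by omega) k htm).trans ?_
  rw [← Finset.mul_sum]
  have hedge : (2 : ℝ) ^ (r + 2) / (r + 1) ≤ 2 ^ (r + 2) / r := by
    gcongr
    linarith
  have hrf : (r.factorial : ℝ) ≠ 0 := by positivity
  by_cases h0 : m = 0
  · subst h0
    simp only [zero_add, Nat.factorial_one, Nat.cast_one, one_mul, Nat.sub_zero]
    rw [div_self hrf, one_mul]
    exact (sum_choose_div_farDist_zero_le r).trans hedge
  by_cases h1 : m + 1 = r
  · rw [sum_choose_div_farDist_last h1, h1, show r - m = 1 by omega, Nat.factorial_one,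
      Nat.cast_one, mul_one, div_self hrf, one_mul]
    exact (sum_choose_div_farDist_zero_le r).trans hedge
  -- Away from the two extreme cells the product of all distances is itself small.
  have hfac : ((m + 1).factorial * (r - m).factorial : ℝ) / r.factorial ≤ 2 / r := by
    have h := factorial_mul_factorial_le (a := m + 1) (b := r - m) (by omega) (by omega)
    rw [show m + 1 + (r - m) - 2 = r - 1 by omega] at h
    have h' : ((m + 1).factorial * (r - m).factorial : ℝ) ≤ 2 * (r - 1).factorial := by
      exact_mod_cast h
    have hf : (r.factorial : ℝ) = r * (r - 1).factorial := by
      exact_mod_cast (Nat.mul_factorial_pred (by omega)).symm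
    rw [div_le_div_iff₀ (by positivity) hr0, hf]
    nlinarith
  have hsum : ∑ k : Fin (r + 1), (r.choose k : ℝ) / farDist m k ≤ 2 ^ r := by
    rw [← sum_choose_real]
    exact Finset.sum_le_sum fun k _ => div_le_self (Nat.cast_nonneg _) (one_le_farDist m k)
  calc _ ≤ 2 / (r : ℝ) * 2 ^ r := by
        gcongr
        exact Finset.sum_nonneg fun k _ =>
          div_nonneg (Nat.cast_nonneg _) (zero_le_one.trans (one_le_farDist m k))
    _ = 2 ^ (r + 1) / r := by ring
    _ ≤ 2 ^ (r + 2) / r := by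
        gcongr
        · norm_num
        · omega

theorem segmentLebesgue_eqSegments_le {r : ℕ} (hr : 1 ≤ r) :
    segmentLebesgue (eqLeft r) (eqRight r) ≤ (r : ℝ) * 2 ^ (r + 4) := by
  have hr0 : (0 : ℝ) < r := by positivity
  calc _ ≤ 2 * (r : ℝ) ^ 2 * nodalLebesgue (eqNodes r) := segmentLebesgue_le_mul_nodalLebesgue hr
    _ ≤ 2 * (r : ℝ) ^ 2 * (2 ^ (r + 2) / r) := by
        gcongr
        exact nodalLebesgue_eqNodes_le hr
    _ = (r : ℝ) * 2 ^ (r + 3) := by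
        field_simp
        ring
    _ ≤ (r : ℝ) * 2 ^ (r + 4) := by
        gcongr
        · norm_num
        · omega

/-! ### Exponential growth -/

theorem tendsto_segmentLebesgue_rpow :
    Tendsto (fun r : ℕ => segmentLebesgue (eqLeft r) (eqRight r) ^ (1 / (r : ℝ)))
      atTop (𝓝 2) := by
  have hroot : Tendsto (fun r : ℕ => (r : ℝ) ^ (1 / (r : ℝ))) atTop (𝓝 1) :=
    tendsto_rpow_div.comp tendsto_natCast_atTop_atTop
  have hconst : ∀ c : ℝ, 0 < c → Tendsto (fun r : ℕ => c ^ (1 / (r : ℝ))) atTop (𝓝 1) := by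
    intro c hc
    have h : Tendsto (fun r : ℕ => 1 / (r : ℝ)) atTop (𝓝 0) := tendsto_one_div_atTop_nhds_zero_nat
    simpa using tendsto_const_nhds.rpow h (Or.inl hc.ne')
  have hlow : Tendsto (fun r : ℕ => (1 / (2 * Real.pi)) ^ (1 / (r : ℝ)) *
      2 / ((r : ℝ) ^ (1 / (r : ℝ))) ^ 2) atTop (𝓝 2) := by
    have h := ((hconst (1 / (2 * Real.pi)) (by positivity)).mul_const 2).div (hroot.pow 2)
      (by norm_num)
    rw [one_mul, one_pow, div_one] at h
    exact h
  have hupp : Tendsto (fun r : ℕ => (r : ℝ) ^ (1 / (r : ℝ)) * (2 * 16 ^ (1 / (r : ℝ))))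
      atTop (𝓝 2) := by
    simpa using hroot.mul ((hconst 16 (by norm_num)).const_mul 2)
  have hpow : ∀ {r : ℕ}, 1 ≤ r → ((2 : ℝ) ^ r) ^ (1 / (r : ℝ)) = 2 := by
    intro r hr
    rw [one_div]
    exact Real.pow_rpow_inv_natCast (by norm_num) (by omega)
  refine tendsto_of_tendsto_of_tendsto_of_le_of_le' hlow hupp ?_ ?_
  · filter_upwards [eventually_ge_atTop 1] with r hr
    have hr0 : (0 : ℝ) < r := by positivity
    have h : 1 / (2 * Real.pi) * 2 ^ r / (r : ℝ) ^ 2 ≤ segmentLebesgue (eqLeft r) (eqRight r) := by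
      refine le_of_eq_of_le ?_ (lt_segmentLebesgue hr).le
      obtain ⟨n, rfl⟩ : ∃ n, r = n + 1 := ⟨r - 1, by omega⟩
      rw [Nat.add_sub_cancel, pow_succ]
      field_simp
    refine le_of_eq_of_le (Eq.symm ?_) (Real.rpow_le_rpow (by positivity) h (by positivity))
    rw [Real.div_rpow (by positivity) (by positivity),
      Real.mul_rpow (by positivity) (by positivity),
      hpow hr, ← Real.rpow_pow_comm hr0.le]
  · filter_upwards [eventually_ge_atTop 1] with r hr
    have hr0 : (0 : ℝ) < r := by positivity
    have hnn : 0 ≤ segmentLebesgue (eqLeft r) (eqRight r) :=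
      le_trans (by positivity) (lt_segmentLebesgue hr).le
    refine (Real.rpow_le_rpow hnn (segmentLebesgue_eqSegments_le hr) (by positivity)).trans_eq ?_
    rw [pow_add, Real.mul_rpow hr0.le (by positivity),
      Real.mul_rpow (by positivity) (by norm_num), hpow hr]
    norm_num

end SegInterp

theorem mainTheorem2 :
    (∀ r : ℕ, 1 ≤ r →
      (∃! ℓ : Fin r → Polynomial ℝ,
        SegInterp.IsSegmentLagrangeBasis (SegInterp.eqLeft r) (SegInterp.eqRight r) ℓ) ∧
      (∀ f f' : ℝ → ℂ,
        (∀ x ∈ Icc (-1 : ℝ) 1, HasDerivWithinAt f (f' x) (Icc (-1) 1) x) →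
        IntervalIntegrable f' volume (-1) 1 →
        ∀ x : ℝ, HasDerivAt (SegInterp.nodalInterp (SegInterp.eqNodes r) f)
          (SegInterp.segmentInterp (SegInterp.eqLeft r) (SegInterp.eqRight r) f' x) x) ∧
      1 / Real.pi * ((2 : ℝ) ^ (r - 1) / (r : ℝ) ^ 2) <
        SegInterp.segmentLebesgue (SegInterp.eqLeft r) (SegInterp.eqRight r) ∧
      SegInterp.segmentLebesgue (SegInterp.eqLeft r) (SegInterp.eqRight r) ≤
        2 * (r : ℝ) ^ 2 * SegInterp.nodalLebesgue (SegInterp.eqNodes r) ∧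
      SegInterp.segmentLebesgue (SegInterp.eqLeft r) (SegInterp.eqRight r) ≤
        (r : ℝ) * 2 ^ (r + 4)) ∧
    Tendsto (fun r : ℕ =>
        SegInterp.segmentLebesgue (SegInterp.eqLeft r) (SegInterp.eqRight r) ^ (1 / (r : ℝ)))
      atTop (𝓝 2) := by
  refine ⟨fun r hr => ⟨?_, ?_, ?_, ?_, ?_⟩, SegInterp.tendsto_segmentLebesgue_rpow⟩
  · exact ⟨_, SegInterp.isSegmentLagrangeBasis_derivative_stepPoly hr, fun ℓ hℓ =>
      SegInterp.eq_of_isSegmentLagrangeBasis hr hℓ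
        (SegInterp.isSegmentLagrangeBasis_derivative_stepPoly hr)⟩
  · exact fun f f' hf hint => SegInterp.hasDerivAt_nodalInterp hr hf hint
  · exact SegInterp.lt_segmentLebesgue hr
  · exact SegInterp.segmentLebesgue_le_mul_nodalLebesgue hr
  · exact SegInterp.segmentLebesgue_eqSegments_le hr
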